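/- Fix real numbers $0<p\le 1$, $0\le q\le 1$, $0\le r\le 1$. The 3-interactions model is the following random evolution of a graph whose vertices, edges and triangles carry weights. At time $n=0$ the graph is a single triangle; the triangle, its three edges and its three vertices have weight $1$. At each step $n=1,2,\dots$ three vertices interact: all missing edges between them and the triangle they span are drawn, and the weights of this triangle, of its three edges and of its three vertices are increased by $1$ (so that a newly created object gets weight $1$). Given the past, the three vertices are chosen as follows. - With probability $p$ a new vertex is added, and it interacts with two old vertices. With probability $r$ these two are the end points of an existing edge chosen with probability proportional to its weight; with probability $1-r$ they are chosen uniformly among all pairs of old vertices. - With probability $1-p$ no vertex is added, and three old vertices interact. With probability $q$ they are the vertices of an existing triangle (one drawn in an earlier interaction or at the start) chosen with probability proportional to its weight; with probability $1-q$ they are chosen uniformly among all triples of old vertices. Let $E_n$ be the number of edges, and $E(n,v)$ the number of edges of weight $v$, after the $n$th step. Put $a=\frac13 pr+(1-p)q$. **Theorem.** Assume that $r>0$ or $(1-p)q>0$. Then there are positive numbers $u_1,u_2,\dots$ such that for every fixed $v\ge 1$ $$\frac{E(n,v)}{E_n}\to u_v\quad\text{almost surely as } n\to\infty .$$ They satisfy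 $$u_1=\frac1{a+1},\qquad u_v=\frac{(v-1)a}{va+1}\,u_{v-1}\quad (v>1),$$ the sequence $u_1,u_2,\dots$ is a proper probability distribution, i.e. $\sum_{v\ge1}u_v=1$, and $$u_v\sim \frac{\Gamma\left(1+\frac1a\right)}{a}\,v^{-\left(1+\frac1a\right)}\quad\text{as } v\to\infty,$$ where $x_v\sim y_v$ means $x_v/y_v\to1$. -/

import Mathlib

open MeasureTheory Filter Topology

noncomputable section

/-- A state of the evolving weighted graph. The vertices are `0, …, numVertices - 1`, and `weight S`
is the weight of the clique with vertex set `S` (a vertex, an edge or a triangle according as `S`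
has one, two or three elements). A clique that has not been drawn has weight `0`; since every drawn
clique has initial weight `1` and weights never decrease, a clique is present exactly when its
weight is positive. -/
@[ext]
structure WeightedCliqueGraph where
  numVertices : ℕ
  weight : Finset ℕ → ℕ

namespace WeightedCliqueGraph

/-- The set of all vertices. -/
def vertices (G : WeightedCliqueGraph) : Finset ℕ := Finset.range G.numVertices

/-- All pairs of different vertices, joined by an edge or not. -/
def pairs (G : WeightedCliqueGraph) : Finset (Finset ℕ) := G.vertices.powersetCard 2

/-- All sets of three different vertices, forming a triangle of the graph or not. -/
def triples (G : WeightedCliqueGraph) : Finset (Finset ℕ) := G.vertices.powersetCard 3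

/-- The existing edges. -/
def edges (G : WeightedCliqueGraph) : Finset (Finset ℕ) := {e ∈ G.pairs | 0 < G.weight e}

/-- The existing triangles (those drawn in some interaction). -/
def triangles (G : WeightedCliqueGraph) : Finset (Finset ℕ) := {t ∈ G.triples | 0 < G.weight t}

/-- The existing edges of weight `v`. -/
def edgesOfWeight (G : WeightedCliqueGraph) (v : ℕ) : Finset (Finset ℕ) :=
  {e ∈ G.edges | G.weight e = v}

/-- The label given to the next new vertex. -/
def newVertex (G : WeightedCliqueGraph) : ℕ := G.numVertices

/-- The starting point: one triangle; it, its three edges and its three vertices have weight `1`. -/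
def initial : WeightedCliqueGraph where
  numVertices := 3
  weight S := if S.Nonempty ∧ S ⊆ Finset.range 3 then 1 else 0

/-- The interaction of the three vertices in `T`: if `T` contains the new vertex, this vertex is
added to the graph; missing edges and the triangle are drawn, and the weights of the triangle `T`,
of its edges and of its vertices are increased by `1` (new objects thus get weight `1`). -/
def interact (G : WeightedCliqueGraph) (T : Finset ℕ) : WeightedCliqueGraph where
  numVertices := if G.newVertex ∈ T then G.numVertices + 1 else G.numVertices
  weight S := if S.Nonempty ∧ S ⊆ T then G.weight S + 1 else G.weight S

/-- The probability of `e` when an existing edge is chosen with probability proportional to its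
weight. -/
def edgePrefProb (G : WeightedCliqueGraph) (e : Finset ℕ) : ℝ :=
  if e ∈ G.edges then (G.weight e : ℝ) / ∑ h ∈ G.edges, (G.weight h : ℝ) else 0

/-- The probability of `e` when two existing vertices are chosen uniformly. -/
def pairUnifProb (G : WeightedCliqueGraph) (e : Finset ℕ) : ℝ :=
  if e ∈ G.pairs then 1 / (G.pairs.card : ℝ) else 0

/-- The probability of `t` when an existing triangle is chosen with probability proportional to its
weight. -/
def trianglePrefProb (G : WeightedCliqueGraph) (t : Finset ℕ) : ℝ :=
  if t ∈ G.triangles then (G.weight t : ℝ) / ∑ h ∈ G.triangles, (G.weight h : ℝ) else 0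

/-- The probability of `t` when three existing vertices are chosen uniformly. -/
def tripleUnifProb (G : WeightedCliqueGraph) (t : Finset ℕ) : ℝ :=
  if t ∈ G.triples then 1 / (G.triples.card : ℝ) else 0

/-- The probability that `T` is the set of the three vertices interacting in the next step.
With probability `p` a new vertex interacts with two old ones, which are the end points of an edge
chosen by preferential attachment with probability `r`, and are chosen uniformly with probability
`1 - r`. With probability `1 - p` three old vertices interact, which form a triangle chosen by
preferential attachment with probability `q`, and are chosen uniformly with probability `1 - q`. -/
def interactionProb (p q r : ℝ) (G : WeightedCliqueGraph) (T : Finset ℕ) : ℝ :=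
  if G.newVertex ∈ T then
    p * (r * G.edgePrefProb (T.erase G.newVertex) + (1 - r) * G.pairUnifProb (T.erase G.newVertex))
  else
    (1 - p) * (q * G.trianglePrefProb T + (1 - q) * G.tripleUnifProb T)

/-- The graph after `n` steps, when for every `k ≥ 1` the vertices in `T k` interact in step `k`
(the value `T 0` is not used). -/
def afterSteps (T : ℕ → Finset ℕ) : ℕ → WeightedCliqueGraph
  | 0 => initial
  | n + 1 => (afterSteps T n).interact (T (n + 1))

end WeightedCliqueGraph

/-- The random sets `T 1, T 2, …` are the successive interacting triples of a 3-interactions model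
with parameters `p`, `q`, `r`: the set `T (n + 1)` is observable after step `n + 1`, and its
conditional distribution given the events observable after step `n` is the one prescribed by the
choice rule applied to the graph after `n` steps. -/
structure IsThreeInteractionsModel {Ω : Type*} {mΩ : MeasurableSpace Ω} (μ : Measure Ω)
    (p q r : ℝ) (ℱ : Filtration ℕ mΩ) (T : ℕ → Ω → Finset ℕ) : Prop where
  measurableSet_eq : ∀ (n : ℕ) (S : Finset ℕ), MeasurableSet[ℱ (n + 1)] {ω | T (n + 1) ω = S}
  condProb_eq : ∀ (n : ℕ) (S : Finset ℕ),
    μ[Set.indicator {ω | T (n + 1) ω = S} (fun _ => (1 : ℝ)) | ℱ n] =ᵐ[μ]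
      fun ω => (WeightedCliqueGraph.afterSteps (fun k => T k ω) n).interactionProb p q r S

/-- `E_n`, the number of all edges after the `n`th step. -/
def numEdges {Ω : Type*} (T : ℕ → Ω → Finset ℕ) (n : ℕ) (ω : Ω) : ℕ :=
  (WeightedCliqueGraph.afterSteps (fun k => T k ω) n).edges.card

/-- `E(n, v)`, the number of edges of weight `v` after the `n`th step. -/
def numEdgesOfWeight {Ω : Type*} (T : ℕ → Ω → Finset ℕ) (n v : ℕ) (ω : Ω) : ℕ :=
  ((WeightedCliqueGraph.afterSteps (fun k => T k ω) n).edgesOfWeight v).card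

end

/-! Each interaction adds 3 to the total weight of the pairs and 1 to that of the triples, so after
`n` steps these are `3(n+1)` and `n+1`. Moreover the weight of an edge is the sum of the weights of
the triangles containing it. Hence, given the past, an edge of weight `w` takes part in the next
interaction with probability `a w/(n+1)` plus a uniform contribution of order `V⁻²`, where `V` is
the number of vertices (`sum_interactionProb_superset`). A new vertex arrives with probability `p >
0`, so `V ~ p n` almost surely; as there are at most `3(n+1)` edges, the uniform contributions, even
summed over all edges, vanish in the limit.

Up to vanishing terms, the conditional mean increment is therefore `3(1-a)` for `E_n`, and
`a(v-1)E(n,v-1)/(n+1) - a v E(n,v)/(n+1)` for `E(n,v)` with `v > 1`; for `v = 1` the gain is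
`3(1-a)`. The strong law for bounded martingale differences lets the real increments be replaced by
these means, on average. A sequence with mean increments `c - α z/(n+1)` grows like `c n/(1+α)`
(`tendsto_div_of_increments`). By induction on `v` this gives `E(n,v) ~ 3(1-a) u_v n` with the
stated recursion, and dividing by `E_n ~ 3(1-a) n` gives the limit.

The recursion telescopes, which yields the partial sums of `u`, and it solves to a quotient of a
factorial by a rising product, so that Euler's limit formula for `Γ` gives the tail. -/

/-! ### Averages and linear growth of real sequences. -/

/-- Kronecker's lemma with the weights `k + 1`. -/
theorem tendsto_sum_div_of_tendsto_sum_div_succ {x : ℕ → ℝ} {s : ℝ}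
    (h : Tendsto (fun n => ∑ k ∈ Finset.range n, x k / ((k : ℝ) + 1)) atTop (𝓝 s)) :
    Tendsto (fun n : ℕ => (∑ k ∈ Finset.range n, x k) / (n : ℝ)) atTop (𝓝 0) := by
  set t : ℕ → ℝ := fun n => ∑ k ∈ Finset.range n, x k / ((k : ℝ) + 1) with ht
  -- Summation by parts. After division by `n`, both terms on the right tend to `s`, the second one
  -- by Cesàro.
  have key : ∀ n : ℕ, ∑ k ∈ Finset.range n, x k = n * t n - ∑ k ∈ Finset.range n, t k := by
    intro n
    induction n with
    | zero => simp
    | succ n ih =>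
      have h1 : t (n + 1) = t n + x n / ((n : ℝ) + 1) := by simp [ht, Finset.sum_range_succ]
      rw [Finset.sum_range_succ, Finset.sum_range_succ, ih, h1]
      have : (n : ℝ) + 1 ≠ 0 := by positivity
      push_cast
      field_simp
      ring
  have h2 := h.sub h.cesaro
  rw [sub_self] at h2
  refine h2.congr' ?_
  filter_upwards [eventually_gt_atTop 0] with n hn
  have : (n : ℝ) ≠ 0 := by positivity
  rw [key]
  field_simp

/-- The solution of `z (n + 1) = z n * (1 - α / (n + 1)) + c n` with `c n → β * (1 + α)` grows
like `β * n`. -/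
theorem tendsto_div_of_recurrence {z c : ℕ → ℝ} {α β : ℝ} (hα : 0 ≤ α)
    (hc : Tendsto c atTop (𝓝 (β * (1 + α))))
    (hz : ∀ n : ℕ, z (n + 1) = z n * (1 - α / ((n : ℝ) + 1)) + c n) :
    Tendsto (fun n : ℕ => z n / (n : ℝ)) atTop (𝓝 β) := by
  set d : ℕ → ℝ := fun n => z n - β * n with hd
  set η : ℕ → ℝ := fun n => |c n - β * (1 + α) + β * α / ((n : ℝ) + 1)| with hη
  have hη0 : Tendsto η atTop (𝓝 0) := by
    have h1 : Tendsto (fun n : ℕ => β * α / ((n : ℝ) + 1)) atTop (𝓝 0) :=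
      tendsto_const_nhds.div_atTop (tendsto_atTop_add_const_right _ _ tendsto_natCast_atTop_atTop)
    have h2 := (hc.sub_const (β * (1 + α))).add h1
    simpa using h2.abs
  -- From index `N` on, the factor `1 - α/(n+1)` lies in `[0,1]`, so the deviation `d` grows by at
  -- most the null sequence `η` per step and is `o(n)`.
  obtain ⟨N, hN⟩ := exists_nat_ge α
  have hstep : ∀ n, N ≤ n → |d (n + 1)| ≤ |d n| + η n := by
    intro n hn
    have hpos : (0 : ℝ) < (n : ℝ) + 1 := by positivity
    have hNn : (N : ℝ) ≤ n := by exact_mod_cast hn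
    have heq : d (n + 1) = d n * (1 - α / ((n : ℝ) + 1)) +
        (c n - β * (1 + α) + β * α / ((n : ℝ) + 1)) := by
      simp only [hd, hz]
      push_cast
      field_simp
      ring
    have hle : |1 - α / ((n : ℝ) + 1)| ≤ 1 := by
      have h1 : α / ((n : ℝ) + 1) ≤ 1 := by
        rw [div_le_one hpos]; linarith
      have h2 : 0 ≤ α / ((n : ℝ) + 1) := by positivity
      rw [abs_le]; constructor <;> linarith
    rw [heq]
    refine (abs_add_le _ _).trans ?_
    rw [abs_mul]
    gcongr
    exact mul_le_of_le_one_right (abs_nonneg _) hle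
  have hbound : ∀ n, N ≤ n → |d n| ≤ |d N| + ∑ k ∈ Finset.range n, η k := by
    intro n hn
    induction n, hn using Nat.le_induction with
    | base =>
      have : 0 ≤ ∑ k ∈ Finset.range N, η k := Finset.sum_nonneg fun k _ => abs_nonneg _
      linarith
    | succ n hn ih =>
      rw [Finset.sum_range_succ]
      linarith [hstep n hn]
  have hlim : Tendsto (fun n : ℕ => |d N| / (n : ℝ) + (n : ℝ)⁻¹ * ∑ k ∈ Finset.range n, η k)
      atTop (𝓝 0) := by
    simpa using (tendsto_const_nhds.div_atTop tendsto_natCast_atTop_atTop).add hη0.cesaro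
  have hd0 : Tendsto (fun n : ℕ => d n / (n : ℝ)) atTop (𝓝 0) := by
    refine squeeze_zero_norm' ?_ hlim
    filter_upwards [eventually_ge_atTop N, eventually_gt_atTop 0] with n hn hn0
    have hpos : (0 : ℝ) < n := by exact_mod_cast hn0
    rw [Real.norm_eq_abs, abs_div, abs_of_pos hpos, ← div_eq_inv_mul, ← add_div]
    gcongr
    exact hbound n hn
  have := hd0.add_const β
  rw [zero_add] at this
  refine this.congr' ?_
  filter_upwards [eventually_gt_atTop 0] with n hn
  have : (n : ℝ) ≠ 0 := by positivity
  simp only [hd]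
  field_simp
  ring

/-! ### A strong law for bounded martingale differences. -/

section

variable {Ω : Type*} {mΩ : MeasurableSpace Ω} {μ : Measure Ω} [IsProbabilityMeasure μ]
  {ℱ : Filtration ℕ mΩ}

/-- The strong law of large numbers for bounded martingale differences. -/
theorem ae_tendsto_sum_div_of_condExp_eq_zero {ξ : ℕ → Ω → ℝ} {C : ℝ}
    (hmeas : ∀ n, StronglyMeasurable[ℱ (n + 1)] (ξ n)) (hbdd : ∀ n, ∀ᵐ ω ∂μ, |ξ n ω| ≤ C)
    (hzero : ∀ n, μ[ξ n | ℱ n] =ᵐ[μ] 0) :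
    ∀ᵐ ω ∂μ, Tendsto (fun n : ℕ => (∑ k ∈ Finset.range n, ξ k ω) / (n : ℝ)) atTop (𝓝 0) := by
  set N : ℕ → Ω → ℝ := fun n ω => ∑ k ∈ Finset.range n, ξ k ω / ((k : ℝ) + 1) with hNdef
  have hNsucc : ∀ n ω, N (n + 1) ω = N n ω + ξ n ω / ((n : ℝ) + 1) := fun n ω => by
    simp [hNdef, Finset.sum_range_succ]
  have hadp : StronglyAdapted ℱ N := by
    intro n
    refine Finset.stronglyMeasurable_fun_sum _ fun k hk => ?_
    have hk' : k + 1 ≤ n := Finset.mem_range.1 hk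
    simp_rw [div_eq_mul_inv]
    exact ((hmeas k).mono (ℱ.mono hk')).mul_const _
  have hNm : ∀ n, AEStronglyMeasurable (N n) μ := fun n =>
    ((hadp n).mono (ℱ.le n)).aestronglyMeasurable
  have hξm : ∀ n, AEStronglyMeasurable (ξ n) μ := fun n =>
    ((hmeas n).mono (ℱ.le _)).aestronglyMeasurable
  have hNb : ∀ n, ∃ B, ∀ᵐ ω ∂μ, |N n ω| ≤ B := by
    intro n
    refine ⟨∑ k ∈ Finset.range n, C / ((k : ℝ) + 1), ?_⟩
    filter_upwards [ae_all_iff.2 hbdd] with ω hω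
    refine (Finset.abs_sum_le_sum_abs _ _).trans (Finset.sum_le_sum fun k _ => ?_)
    have hk : (0 : ℝ) < (k : ℝ) + 1 := by positivity
    rw [abs_div, abs_of_pos hk]
    gcongr
    exact hω k
  have hξi : ∀ n, Integrable (ξ n) μ := fun n => Integrable.of_bound (hξm n) C (hbdd n)
  have hNi : ∀ n, Integrable (N n) μ := fun n => by
    obtain ⟨B, hB⟩ := hNb n
    exact Integrable.of_bound (hNm n) B hB
  have hmart : Martingale N ℱ μ := by
    refine martingale_of_condExp_sub_eq_zero_nat hadp hNi fun n => ?_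
    have h1 : N (n + 1) - N n = (((n : ℝ) + 1)⁻¹) • ξ n := by
      ext ω
      simp [hNsucc, div_eq_inv_mul]
    rw [h1]
    refine (condExp_smul _ _ _).trans ?_
    filter_upwards [hzero n] with ω hω
    simp [hω]
  -- Orthogonality of increments: it removes the cross term when `N (n + 1)` is squared, so the
  -- weights `1/(k+1)` keep the martingale bounded in `L²`.
  have horth : ∀ n, ∫ ω, N n ω * ξ n ω ∂μ = 0 := by
    intro n
    obtain ⟨B, hB⟩ := hNb n
    have h1 := condExp_stronglyMeasurable_mul_of_bound (ℱ.le n) (hadp n) (hξi n) B hB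
    have h2 := integral_condExp (ℱ.le n) (μ := μ) (f := N n * ξ n)
    have h3 : ∫ ω, (N n * ξ n) ω ∂μ = 0 := by
      rw [← h2, integral_congr_ae h1]
      have : (N n * μ[ξ n | ℱ n]) =ᵐ[μ] 0 := by
        filter_upwards [hzero n] with ω hω
        simp [hω]
      rw [integral_congr_ae this]
      simp
    exact h3
  have hNN : ∀ n, Integrable (fun ω => N n ω ^ 2) μ := fun n => by
    obtain ⟨B, hB⟩ := hNb n
    refine Integrable.of_bound ((hNm n).pow 2) (B ^ 2) ?_
    filter_upwards [hB] with ω hω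
    rw [Real.norm_eq_abs, abs_pow]
    gcongr
  have hNξ : ∀ n, Integrable (fun ω => N n ω * ξ n ω) μ := fun n => by
    obtain ⟨B, hB⟩ := hNb n
    refine Integrable.of_bound ((hNm n).mul (hξm n)) (B * C) ?_
    filter_upwards [hB, hbdd n] with ω h1 h2
    rw [Real.norm_eq_abs, abs_mul]
    exact mul_le_mul h1 h2 (abs_nonneg _) ((abs_nonneg _).trans h1)
  have hξξ : ∀ n, Integrable (fun ω => ξ n ω ^ 2) μ := fun n => by
    refine Integrable.of_bound ((hξm n).pow 2) (C ^ 2) ?_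
    filter_upwards [hbdd n] with ω hω
    rw [Real.norm_eq_abs, abs_pow]
    gcongr
  have hL2 : ∀ n, ∫ ω, N n ω ^ 2 ∂μ ≤ ∑ k ∈ Finset.range n, C ^ 2 * (1 / ((k : ℝ) + 1) ^ 2) := by
    intro n
    induction n with
    | zero => simp [hNdef]
    | succ n ih =>
      have h1 : ∀ ω, N (n + 1) ω ^ 2 = N n ω ^ 2 + ((2 / ((n : ℝ) + 1)) * (N n ω * ξ n ω) +
          (1 / ((n : ℝ) + 1) ^ 2) * ξ n ω ^ 2) := by
        intro ω
        rw [hNsucc]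
        have : (n : ℝ) + 1 ≠ 0 := by positivity
        field_simp
        ring
      have h2 : Integrable (fun ω => (2 / ((n : ℝ) + 1)) * (N n ω * ξ n ω) +
          (1 / ((n : ℝ) + 1) ^ 2) * ξ n ω ^ 2) μ :=
        ((hNξ n).const_mul _).add ((hξξ n).const_mul _)
      simp_rw [h1]
      rw [integral_add (hNN n) h2, integral_add ((hNξ n).const_mul _) ((hξξ n).const_mul _), integral_const_mul,
        integral_const_mul, horth, mul_zero, zero_add, Finset.sum_range_succ, mul_comm (C ^ 2)
        (1 / ((n : ℝ) + 1) ^ 2)]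
      gcongr
      calc ∫ ω, ξ n ω ^ 2 ∂μ ≤ ∫ _, C ^ 2 ∂μ := by
            refine integral_mono_ae (hξξ n) (integrable_const _) ?_
            filter_upwards [hbdd n] with ω hω
            exact sq_le_sq' (abs_le.1 hω).1 (abs_le.1 hω).2
        _ = C ^ 2 := by simp
  have hsum : Summable fun k : ℕ => C ^ 2 * (1 / ((k : ℝ) + 1) ^ 2) := by
    refine Summable.mul_left _ ?_
    have := (summable_nat_add_iff 1).2 (Real.summable_one_div_nat_pow.2 one_lt_two)
    simpa using this
  -- The `L²` bound gives an `L¹` bound through `|x| ≤ 1 + x²`, which suffices for almost sure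
  -- convergence; Kronecker's lemma then finishes.
  set R : ℝ := 1 + ∑' k : ℕ, C ^ 2 * (1 / ((k : ℝ) + 1) ^ 2) with hR
  have hL1 : ∀ n, eLpNorm (N n) 1 μ ≤ (R.toNNReal : ENNReal) := by
    intro n
    rw [eLpNorm_one_eq_lintegral_enorm, ← ofReal_integral_norm_eq_lintegral_enorm (hNi n)]
    refine ENNReal.ofReal_le_ofReal ?_
    calc ∫ ω, ‖N n ω‖ ∂μ ≤ ∫ ω, (1 + N n ω ^ 2) ∂μ := by
          refine integral_mono (hNi n).norm ((integrable_const _).add (hNN n)) fun ω => ?_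
          simp only [Real.norm_eq_abs]
          rw [← sq_abs]
          nlinarith [sq_nonneg (|N n ω| - 1), abs_nonneg (N n ω)]
      _ = 1 + ∫ ω, N n ω ^ 2 ∂μ := by
          rw [integral_add (integrable_const _) (hNN n)]
          simp
      _ ≤ R := by
          rw [hR]
          gcongr
          exact (hL2 n).trans (hsum.sum_le_tsum _ fun k _ => by positivity)
  filter_upwards [hmart.submartingale.exists_ae_tendsto_of_bdd hL1] with ω hω
  obtain ⟨c, hc⟩ := hω
  exact tendsto_sum_div_of_tendsto_sum_div_succ hc

/-- The strong law of large numbers for bounded adapted sequences centred at their conditional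
expectations. -/
theorem ae_tendsto_sum_sub_condExp_div {D : ℕ → Ω → ℝ} {C : ℝ}
    (hmeas : ∀ n, StronglyMeasurable[ℱ (n + 1)] (D n)) (hbdd : ∀ n, ∀ᵐ ω ∂μ, |D n ω| ≤ C) :
    ∀ᵐ ω ∂μ, Tendsto (fun n : ℕ => (∑ k ∈ Finset.range n, (D k ω - (μ[D k | ℱ k]) ω)) / (n : ℝ))
      atTop (𝓝 0) := by
  have hi : ∀ n, Integrable (D n) μ := fun n =>
    Integrable.of_bound ((hmeas n).mono (ℱ.le _)).aestronglyMeasurable C (hbdd n)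
  refine ae_tendsto_sum_div_of_condExp_eq_zero (ξ := fun n ω => D n ω - (μ[D n | ℱ n]) ω)
    (ℱ := ℱ) (C := C + C) (fun n => ?_) (fun n => ?_) fun n => ?_
  · exact (hmeas n).sub (stronglyMeasurable_condExp.mono (ℱ.mono n.le_succ))
  · have h1 := ae_bdd_abs_condExp_of_ae_bdd_abs (m := ℱ n) (hbdd n)
    filter_upwards [h1, hbdd n] with ω h1 h2
    exact (abs_sub _ _).trans (add_le_add h2 h1)
  · refine (condExp_sub (hi n) integrable_condExp _).trans ?_
    have := condExp_condExp_of_le (μ := μ) (f := D n) (le_refl (ℱ n)) (ℱ.le n)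
    filter_upwards [this] with ω hω
    simp [hω]

end

/-! ### The limit distribution and its tail. -/

/-- The limiting proportion of the edges of weight `v`. -/
noncomputable def limitWeight (a : ℝ) : ℕ → ℝ
  | 0 => 0
  | 1 => 1 / (a + 1)
  | v + 2 => (((v + 2 : ℕ) : ℝ) - 1) * a / (((v + 2 : ℕ) : ℝ) * a + 1) * limitWeight a (v + 1)

theorem limitWeight_succ (a : ℝ) {v : ℕ} (hv : 1 < v) :
    limitWeight a v = ((v : ℝ) - 1) * a / ((v : ℝ) * a + 1) * limitWeight a (v - 1) := by
  obtain ⟨k, rfl⟩ := Nat.exists_eq_add_of_le' hv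
  simp only [Nat.succ_eq_add_one, Nat.reduceAdd]
  rw [limitWeight]
  rfl

theorem limitWeight_pos {a : ℝ} (ha : 0 < a) {v : ℕ} (hv : 1 ≤ v) : 0 < limitWeight a v := by
  induction v, hv using Nat.le_induction with
  | base => simp only [limitWeight]; positivity
  | succ n hn ih =>
    rw [limitWeight_succ a (by omega)]
    have : (0 : ℝ) < n := by exact_mod_cast hn
    push_cast
    simp only [add_sub_cancel_right]
    positivity

/-- The recursion is equivalent to `u_v = a((v-1)u_{v-1} - v u_v)`, so the sum telescopes; the 1
comes from `u_1 = 1 - a u_1`. -/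
theorem sum_limitWeight {a : ℝ} (ha : 0 < a) (n : ℕ) :
    ∑ k ∈ Finset.range (n + 1), limitWeight a (k + 1) =
      1 - a * (((n : ℝ) + 1) * limitWeight a (n + 1)) := by
  induction n with
  | zero => simp [limitWeight]; field_simp; ring
  | succ n ih =>
    rw [Finset.sum_range_succ, ih, limitWeight_succ a (v := n + 1 + 1) (by omega)]
    have : (((n + 1 + 1 : ℕ) : ℝ) * a + 1) ≠ 0 := by positivity
    simp only [Nat.add_sub_cancel]
    push_cast at this ⊢
    field_simp
    ring

/-- Dividing numerator and denominator of the recursion by `a` gives the factor `(v-1)/(v + 1/a)`.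
The product is the denominator of `Real.GammaSeq` at `1 + 1/a`. -/
theorem limitWeight_eq_prod {a : ℝ} (ha : 0 < a) (n : ℕ) :
    limitWeight a (n + 1) =
      (n.factorial : ℝ) / (a * ∏ j ∈ Finset.range (n + 1), (1 + 1 / a + j)) := by
  have hprod : ∀ m : ℕ, ∏ j ∈ Finset.range m, (1 + 1 / a + (j : ℝ)) ≠ 0 := fun m =>
    Finset.prod_ne_zero_iff.2 fun j _ => by positivity
  induction n with
  | zero => simp [limitWeight]; field_simp
  | succ n ih =>
    rw [limitWeight_succ a (v := n + 1 + 1) (by omega), Nat.add_sub_cancel, ih,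
      Finset.prod_range_succ _ (n + 1), Nat.factorial_succ]
    have h1 := hprod (n + 1)
    have h2 : 1 + 1 / a + ((n + 1 : ℕ) : ℝ) = (((n + 1 + 1 : ℕ) : ℝ) * a + 1) / a := by
      push_cast
      field_simp
      ring
    rw [h2]
    set P := ∏ j ∈ Finset.range (n + 1), (1 + 1 / a + (j : ℝ))
    have : (((n + 1 + 1 : ℕ) : ℝ) * a + 1) ≠ 0 := by positivity
    push_cast at this ⊢
    field_simp
    ring

theorem tendsto_limitWeight_div {a : ℝ} (ha : 0 < a) :
    Tendsto (fun v : ℕ =>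
      limitWeight a v / (Real.Gamma (1 + 1 / a) / a * (v : ℝ) ^ (-(1 + 1 / a)))) atTop (𝓝 1) := by
  set s := 1 + 1 / a with hs
  have hs0 : 0 < s := by positivity
  have hΓ : Real.Gamma s ≠ 0 := (Real.Gamma_pos_of_pos hs0).ne'
  rw [← tendsto_add_atTop_iff_nat 1]
  have h1 : Tendsto (fun n : ℕ => ((n : ℝ) + 1) / n) atTop (𝓝 1) := by
    have := tendsto_const_nhds (x := (1 : ℝ)).add
      (tendsto_const_div_atTop_nhds_zero_nat (1 : ℝ))
    rw [add_zero] at this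
    refine this.congr' ?_
    filter_upwards [eventually_gt_atTop 0] with n hn
    have : (n : ℝ) ≠ 0 := by positivity
    field_simp
  have h2 : Tendsto (fun n : ℕ => (((n : ℝ) + 1) / n) ^ s) atTop (𝓝 1) := by
    simpa using h1.rpow_const (p := s) (Or.inl one_ne_zero)
  -- With `v = n + 1`, `GammaSeq s n` equals `a n^s u_v`; the factor `((n+1)/n)^s` turns `n^s` into
  -- `v^s`.
  have h3 := ((Real.GammaSeq_tendsto_Gamma s).div_const (Real.Gamma s)).mul h2
  rw [div_self hΓ, mul_one] at h3
  refine h3.congr' ?_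
  filter_upwards [eventually_gt_atTop 0] with n hn
  have hn0 : (0 : ℝ) < n := by exact_mod_cast hn
  have hP : ∏ j ∈ Finset.range (n + 1), (s + (j : ℝ)) ≠ 0 :=
    Finset.prod_ne_zero_iff.2 fun j _ => by positivity
  rw [limitWeight_eq_prod ha, Real.GammaSeq, Real.rpow_neg (by positivity),
    Real.div_rpow (by positivity) hn0.le]
  have h4 : (n : ℝ) ^ s ≠ 0 := (Real.rpow_pos_of_pos hn0 s).ne'
  have h5 : ((n : ℝ) + 1) ^ s ≠ 0 := (Real.rpow_pos_of_pos (by positivity) s).ne'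
  push_cast
  rw [← hs]
  field_simp

/-- By the tail asymptotics, `n u_n` is of order `n^(-1/a)`. This is the boundary term of the
telescoped sum. -/
theorem tendsto_mul_limitWeight {a : ℝ} (ha : 0 < a) :
    Tendsto (fun n : ℕ => (n : ℝ) * limitWeight a n) atTop (𝓝 0) := by
  set s := 1 + 1 / a with hs
  have hs0 : 0 < s := by positivity
  have hΓ : Real.Gamma s ≠ 0 := (Real.Gamma_pos_of_pos hs0).ne'
  have h1 : Tendsto (fun n : ℕ => (n : ℝ) ^ (-(1 / a))) atTop (𝓝 0) :=
    (tendsto_rpow_neg_atTop (by positivity)).comp tendsto_natCast_atTop_atTop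
  have h2 := ((tendsto_limitWeight_div ha).mul h1).mul_const (Real.Gamma s / a)
  rw [mul_zero, zero_mul] at h2
  refine h2.congr' ?_
  filter_upwards [eventually_gt_atTop 0] with n hn
  have hn0 : (0 : ℝ) < n := by exact_mod_cast hn
  have h3 : (n : ℝ) ^ (-(1 / a)) = n * (n : ℝ) ^ (-s) := by
    rw [hs, neg_add, Real.rpow_add hn0, Real.rpow_neg_one]
    field_simp
  have h4 : (n : ℝ) ^ (-s) ≠ 0 := (Real.rpow_pos_of_pos hn0 _).ne'
  rw [h3, ← hs]
  field_simp

theorem hasSum_limitWeight {a : ℝ} (ha : 0 < a) : HasSum (fun k => limitWeight a (k + 1)) 1 := by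
  rw [hasSum_iff_tendsto_nat_of_nonneg fun k => (limitWeight_pos ha k.succ_pos).le]
  rw [← tendsto_add_atTop_iff_nat 1]
  simp_rw [sum_limitWeight ha]
  have := ((tendsto_add_atTop_iff_nat 1).2 (tendsto_mul_limitWeight ha)).const_mul a
  simpa using tendsto_const_nhds (x := (1 : ℝ)).sub this

/-! ### The deterministic effect of one interaction. -/

namespace WeightedCliqueGraph

/-- The vertex sets that can interact: three different vertices, at most one of them new. -/
def candidates (G : WeightedCliqueGraph) : Finset (Finset ℕ) :=
  (Finset.range (G.numVertices + 1)).powersetCard 3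

/-- The edges of weight `v` that are contained in `S`. -/
def hits (G : WeightedCliqueGraph) (v : ℕ) (S : Finset ℕ) : Finset (Finset ℕ) :=
  {e ∈ G.edgesOfWeight v | e ⊆ S}

/-- The edges that are contained in `S`. -/
def allHits (G : WeightedCliqueGraph) (S : Finset ℕ) : Finset (Finset ℕ) :=
  {e ∈ G.edges | e ⊆ S}

/-- The properties that all graphs obtained after `n` interactions have in common. -/
structure Wellformed (G : WeightedCliqueGraph) (n : ℕ) : Prop where
  three_le : 3 ≤ G.numVertices
  support : ∀ S, 0 < G.weight S → S ⊆ G.vertices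
  edge_weight : ∀ e, e.card = 2 → G.weight e = ∑ t ∈ G.triples with e ⊆ t, G.weight t
  sum_pairs : ∑ e ∈ G.pairs, G.weight e = 3 * (n + 1)
  sum_triples : ∑ t ∈ G.triples, G.weight t = n + 1

theorem mem_pairs {G : WeightedCliqueGraph} {e : Finset ℕ} :
    e ∈ G.pairs ↔ e ⊆ G.vertices ∧ e.card = 2 := Finset.mem_powersetCard

theorem mem_triples {G : WeightedCliqueGraph} {t : Finset ℕ} :
    t ∈ G.triples ↔ t ⊆ G.vertices ∧ t.card = 3 := Finset.mem_powersetCard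

theorem mem_candidates {G : WeightedCliqueGraph} {t : Finset ℕ} :
    t ∈ G.candidates ↔ t ⊆ Finset.range (G.numVertices + 1) ∧ t.card = 3 :=
  Finset.mem_powersetCard

theorem nonempty_of_card_eq_two {e : Finset ℕ} (he : e.card = 2) : e.Nonempty :=
  Finset.card_pos.1 (by omega)

theorem initial_wellformed : initial.Wellformed 0 where
  three_le := le_rfl
  support S hS := by
    by_contra h
    simp only [initial] at hS
    rw [if_neg fun h' => h h'.2] at hS
    exact lt_irrefl _ hS
  edge_weight e he := by
    have hne := nonempty_of_card_eq_two he
    have ht : initial.triples = {Finset.range 3} := by decide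
    rw [ht, Finset.sum_filter, Finset.sum_singleton]
    by_cases h : e ⊆ Finset.range 3
    · rw [if_pos h]
      simp only [initial]
      rw [if_pos ⟨hne, h⟩, if_pos ⟨by simp, Finset.Subset.refl _⟩]
    · rw [if_neg h]
      simp only [initial]
      rw [if_neg fun h' => h h'.2]
  sum_pairs := by decide
  sum_triples := by decide

variable {G : WeightedCliqueGraph} {n : ℕ} {T : Finset ℕ}

theorem numVertices_le_interact (G : WeightedCliqueGraph) (T : Finset ℕ) :
    G.numVertices ≤ (G.interact T).numVertices := by
  simp only [interact]
  split_ifs <;> omega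

theorem numVertices_interact_le (G : WeightedCliqueGraph) (T : Finset ℕ) :
    (G.interact T).numVertices ≤ G.numVertices + 1 := by
  simp only [interact]
  split_ifs <;> omega

theorem vertices_subset_interact (G : WeightedCliqueGraph) (T : Finset ℕ) :
    G.vertices ⊆ (G.interact T).vertices :=
  Finset.range_mono (G.numVertices_le_interact T)

theorem subset_vertices_interact (hT : T ∈ G.candidates) : T ⊆ (G.interact T).vertices := by
  have h := (mem_candidates.1 hT).1
  intro x hx
  have hx' := Finset.mem_range.1 (h hx)
  simp only [vertices, interact, Finset.mem_range]
  by_cases hV : G.newVertex ∈ T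
  · rw [if_pos hV]
    exact hx'
  · rw [if_neg hV]
    have : x ≠ G.numVertices := fun h => hV ((show x = G.newVertex from h) ▸ hx)
    omega

theorem weight_interact (G : WeightedCliqueGraph) (T : Finset ℕ) {S : Finset ℕ}
    (hS : S.Nonempty) :
    (G.interact T).weight S = G.weight S + if S ⊆ T then 1 else 0 := by
  simp only [interact]
  by_cases h : S ⊆ T
  · rw [if_pos ⟨hS, h⟩, if_pos h]
  · rw [if_neg fun h' => h h'.2, if_neg h, add_zero]

theorem Wellformed.weight_eq_zero (hG : G.Wellformed n) {S : Finset ℕ} (hS : ¬S ⊆ G.vertices) :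
    G.weight S = 0 := by
  by_contra h
  exact hS (hG.support S (Nat.pos_of_ne_zero h))

/-- Sets involving the new vertex had weight 0 before, so enlarging the vertex set does not change
the old sum. The predicate `P` lets one statement serve both the total weights and the triples above
a fixed edge. -/
theorem Wellformed.sum_interact (hG : G.Wellformed n) (hT : T ∈ G.candidates) {k : ℕ}
    (hk : 0 < k) (P : Finset ℕ → Prop) [DecidablePred P] :
    ∑ S ∈ (G.interact T).vertices.powersetCard k with P S, (G.interact T).weight S =
      ∑ S ∈ G.vertices.powersetCard k with P S, G.weight S + Finset.card {S ∈ T.powersetCard k | P S} := by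
  have h1 : ∀ S ∈ (G.interact T).vertices.powersetCard k, (G.interact T).weight S =
      G.weight S + if S ⊆ T then 1 else 0 := fun S hS =>
    G.weight_interact T (Finset.card_pos.1 ((Finset.mem_powersetCard.1 hS).2.symm ▸ hk))
  rw [Finset.sum_congr rfl fun S hS => h1 S (Finset.mem_filter.1 hS).1, Finset.sum_add_distrib]
  congr 1
  · symm
    refine Finset.sum_subset (Finset.filter_subset_filter _
      (Finset.powersetCard_mono (G.vertices_subset_interact T))) fun S hS hS' => ?_
    refine hG.weight_eq_zero fun h => hS' ?_
    rw [Finset.mem_filter, Finset.mem_powersetCard] at hS ⊢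
    exact ⟨⟨h, hS.1.2⟩, hS.2⟩
  · rw [← Finset.card_filter]
    congr 1
    ext S
    simp only [Finset.mem_filter, Finset.mem_powersetCard]
    constructor
    · rintro ⟨⟨⟨-, h⟩, hP⟩, hST⟩
      exact ⟨⟨hST, h⟩, hP⟩
    · rintro ⟨⟨hST, h⟩, hP⟩
      exact ⟨⟨⟨hST.trans (subset_vertices_interact hT), h⟩, hP⟩, hST⟩

/-- For `edge_weight`: `T` is the only triple whose weight rises, so both sides rise by 1 exactly
when `e ⊆ T`. -/
theorem Wellformed.interact (hG : G.Wellformed n) (hT : T ∈ G.candidates) :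
    (G.interact T).Wellformed (n + 1) where
  three_le := hG.three_le.trans (G.numVertices_le_interact T)
  support S hS := by
    by_cases h : S ⊆ T
    · exact h.trans (subset_vertices_interact hT)
    · simp only [WeightedCliqueGraph.interact] at hS
      rw [if_neg fun h' => h h'.2] at hS
      exact (hG.support S hS).trans (G.vertices_subset_interact T)
  edge_weight e he := by
    rw [triples, hG.sum_interact hT (by norm_num), G.weight_interact T (nonempty_of_card_eq_two he),
      hG.edge_weight e he]
    congr 1
    have h : T.powersetCard 3 = {T} := by
      rw [← (mem_candidates.1 hT).2, Finset.powersetCard_self]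
    rw [h, Finset.filter_singleton]
    split_ifs <;> simp
  sum_pairs := by
    have h := hG.sum_interact hT two_pos fun _ => True
    simp only [Finset.filter_true] at h
    rw [pairs, h, Finset.card_powersetCard, (mem_candidates.1 hT).2]
    have := hG.sum_pairs
    rw [pairs] at this
    rw [this, show Nat.choose 3 2 = 3 from rfl]
    ring
  sum_triples := by
    have h := hG.sum_interact hT three_pos fun _ => True
    simp only [Finset.filter_true] at h
    rw [triples, h, Finset.card_powersetCard, (mem_candidates.1 hT).2]
    have := hG.sum_triples
    rw [triples] at this
    rw [this, Nat.choose_self]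

theorem mem_edges {e : Finset ℕ} : e ∈ G.edges ↔ e ∈ G.pairs ∧ 0 < G.weight e :=
  Finset.mem_filter

theorem mem_edgesOfWeight {v : ℕ} {e : Finset ℕ} :
    e ∈ G.edgesOfWeight v ↔ e ∈ G.edges ∧ G.weight e = v :=
  Finset.mem_filter

theorem Wellformed.mem_edges_iff (hG : G.Wellformed n) {e : Finset ℕ} :
    e ∈ G.edges ↔ e.card = 2 ∧ 0 < G.weight e := by
  rw [mem_edges, mem_pairs]
  exact ⟨fun h => ⟨h.1.2, h.2⟩, fun h => ⟨⟨hG.support e h.2, h.1⟩, h.2⟩⟩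

theorem Wellformed.mem_edgesOfWeight_iff (hG : G.Wellformed n) {v : ℕ} (hv : 1 ≤ v)
    {e : Finset ℕ} : e ∈ G.edgesOfWeight v ↔ e.card = 2 ∧ G.weight e = v := by
  rw [mem_edgesOfWeight, hG.mem_edges_iff]
  exact ⟨fun h => ⟨h.1.1, h.2⟩, fun h => ⟨⟨h.1, h.2 ▸ hv⟩, h.2⟩⟩

theorem card_hits_le (G : WeightedCliqueGraph) (v : ℕ) (hT : T.card = 3) :
    (G.hits v T).card ≤ 3 := by
  calc (G.hits v T).card ≤ (T.powersetCard 2).card := by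
        refine Finset.card_le_card fun e he => ?_
        rw [hits, Finset.mem_filter, mem_edgesOfWeight, mem_edges, mem_pairs] at he
        exact Finset.mem_powersetCard.2 ⟨he.2, he.1.1.1.2⟩
    _ = 3 := by rw [Finset.card_powersetCard, hT]; rfl

theorem card_allHits_le (G : WeightedCliqueGraph) (hT : T.card = 3) :
    (G.allHits T).card ≤ 3 := by
  calc (G.allHits T).card ≤ (T.powersetCard 2).card := by
        refine Finset.card_le_card fun e he => ?_
        rw [allHits, Finset.mem_filter, mem_edges, mem_pairs] at he
        exact Finset.mem_powersetCard.2 ⟨he.2, he.1.1.2⟩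
    _ = 3 := by rw [Finset.card_powersetCard, hT]; rfl

theorem Wellformed.card_unhit (hG : G.Wellformed n) (hT : T ∈ G.candidates) :
    Finset.card {e ∈ T.powersetCard 2 | G.weight e = 0} + (G.allHits T).card = 3 := by
  have h1 : G.allHits T = {e ∈ T.powersetCard 2 | ¬G.weight e = 0} := by
    ext e
    rw [allHits, Finset.mem_filter, hG.mem_edges_iff, Finset.mem_filter, Finset.mem_powersetCard]
    constructor
    · rintro ⟨⟨h1, h2⟩, h3⟩
      exact ⟨⟨h3, h1⟩, h2.ne'⟩
    · rintro ⟨⟨h1, h2⟩, h3⟩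
      exact ⟨⟨h2, Nat.pos_of_ne_zero h3⟩, h1⟩
  rw [h1, Finset.card_filter_add_card_filter_not, Finset.card_powersetCard,
    (mem_candidates.1 hT).2]
  rfl

theorem Wellformed.card_edges_interact (hG : G.Wellformed n) (hT : T ∈ G.candidates) :
    (G.interact T).edges.card + (G.allHits T).card = G.edges.card + 3 := by
  have hG' := hG.interact hT
  have h1 : (G.interact T).edges = G.edges ∪ {e ∈ T.powersetCard 2 | G.weight e = 0} := by
    ext e
    rw [hG'.mem_edges_iff, Finset.mem_union, hG.mem_edges_iff, Finset.mem_filter,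
      Finset.mem_powersetCard]
    by_cases he : e.card = 2
    · rw [G.weight_interact T (nonempty_of_card_eq_two he)]
      by_cases h : e ⊆ T
      · simp only [he, h, if_true, true_and]
        omega
      · simp [he, h]
    · simp [he]
  have h2 : Disjoint G.edges {e ∈ T.powersetCard 2 | G.weight e = 0} := by
    rw [Finset.disjoint_left]
    intro e he he'
    exact (mem_edges.1 he).2.ne' (Finset.mem_filter.1 he').2
  rw [h1, Finset.card_union_of_disjoint h2, add_assoc, hG.card_unhit hT]

/-- An edge has weight `v` afterwards if it had it and was not hit, or if it lies in `T` and had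
weight `v - 1`. For `v = 1` the latter are the undrawn pairs, that is, the new edges. The additive
form avoids truncated subtraction. -/
theorem Wellformed.card_edgesOfWeight_interact (hG : G.Wellformed n) (hT : T ∈ G.candidates)
    {v : ℕ} (hv : 1 ≤ v) :
    ((G.interact T).edgesOfWeight v).card + (G.hits v T).card =
      (G.edgesOfWeight v).card + Finset.card {e ∈ T.powersetCard 2 | G.weight e = v - 1} := by
  have hG' := hG.interact hT
  have h1 : (G.interact T).edgesOfWeight v =
      {e ∈ G.edgesOfWeight v | ¬e ⊆ T} ∪ {e ∈ T.powersetCard 2 | G.weight e = v - 1} := by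
    ext e
    rw [hG'.mem_edgesOfWeight_iff hv, Finset.mem_union, Finset.mem_filter,
      hG.mem_edgesOfWeight_iff hv, Finset.mem_filter, Finset.mem_powersetCard]
    by_cases he : e.card = 2
    · rw [G.weight_interact T (nonempty_of_card_eq_two he)]
      by_cases h : e ⊆ T
      · simp only [he, h, if_true, true_and, not_true_eq_false, and_false, false_or]
        omega
      · simp [he, h]
    · simp [he]
  have h2 : Disjoint {e ∈ G.edgesOfWeight v | ¬e ⊆ T}
      {e ∈ T.powersetCard 2 | G.weight e = v - 1} := by
    rw [Finset.disjoint_left]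
    intro e he he'
    exact (Finset.mem_filter.1 he).2 (Finset.mem_powersetCard.1 (Finset.mem_filter.1 he').1).1
  have h3 := Finset.card_filter_add_card_filter_not (s := G.edgesOfWeight v) (fun e => e ⊆ T)
  rw [h1, Finset.card_union_of_disjoint h2, hits]
  omega

theorem Wellformed.card_edgesOfWeight_one_interact (hG : G.Wellformed n)
    (hT : T ∈ G.candidates) :
    ((G.interact T).edgesOfWeight 1).card + (G.hits 1 T).card + (G.allHits T).card =
      (G.edgesOfWeight 1).card + 3 := by
  have h1 := hG.card_edgesOfWeight_interact hT le_rfl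
  have h2 := hG.card_unhit hT
  simp only [Nat.sub_self] at h1
  omega

theorem Wellformed.card_edgesOfWeight_succ_interact (hG : G.Wellformed n)
    (hT : T ∈ G.candidates) {v : ℕ} (hv : 1 ≤ v) :
    ((G.interact T).edgesOfWeight (v + 1)).card + (G.hits (v + 1) T).card =
      (G.edgesOfWeight (v + 1)).card + (G.hits v T).card := by
  rw [hG.card_edgesOfWeight_interact hT (by omega), Nat.add_sub_cancel]
  congr 2
  ext e
  rw [hits, Finset.mem_filter, Finset.mem_filter, hG.mem_edgesOfWeight_iff hv,
    Finset.mem_powersetCard]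
  tauto

theorem Wellformed.card_edges_le (hG : G.Wellformed n) : G.edges.card ≤ 3 * (n + 1) := by
  rw [← hG.sum_pairs, Finset.card_eq_sum_ones]
  calc ∑ e ∈ G.edges, 1 ≤ ∑ e ∈ G.edges, G.weight e :=
        Finset.sum_le_sum fun e he => (mem_edges.1 he).2
    _ ≤ ∑ e ∈ G.pairs, G.weight e :=
        Finset.sum_le_sum_of_subset (Finset.filter_subset _ _)

theorem card_edgesOfWeight_le (G : WeightedCliqueGraph) (v : ℕ) :
    (G.edgesOfWeight v).card ≤ G.edges.card :=
  Finset.card_le_card (Finset.filter_subset _ _)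

end WeightedCliqueGraph

/-! ### Sums over the choice rule: conditional means of one step. -/

namespace WeightedCliqueGraph

variable {G : WeightedCliqueGraph} {n : ℕ} {p q r : ℝ}

theorem newVertex_notMem_of_subset {S : Finset ℕ} (hS : S ⊆ G.vertices) : G.newVertex ∉ S :=
  fun h => by simpa [vertices, newVertex] using hS h

theorem sum_candidates (G : WeightedCliqueGraph) (f : Finset ℕ → ℝ) :
    ∑ S ∈ G.candidates, f S =
      ∑ t ∈ G.triples, f t + ∑ e ∈ G.pairs, f (insert G.newVertex e) := by
  have hnot : G.newVertex ∉ G.vertices := newVertex_notMem_of_subset (Finset.Subset.refl _)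
  have h1 : G.candidates = G.triples ∪ G.pairs.image (insert G.newVertex) := by
    rw [candidates, Finset.range_add_one]
    exact Finset.powersetCard_succ_insert hnot 2
  rw [h1, Finset.sum_union, Finset.sum_image]
  · intro e he e' he' h
    have h2 := newVertex_notMem_of_subset (mem_pairs.1 he).1
    have h3 := newVertex_notMem_of_subset (mem_pairs.1 he').1
    rw [← Finset.erase_insert h2, ← Finset.erase_insert h3]
    exact congrArg (fun s => Finset.erase s G.newVertex) h
  · rw [Finset.disjoint_left]
    intro t ht ht'
    obtain ⟨e, -, rfl⟩ := Finset.mem_image.1 ht'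
    exact newVertex_notMem_of_subset (mem_triples.1 ht).1 (Finset.mem_insert_self _ _)

theorem interactionProb_eq_zero {S : Finset ℕ} (hS : S ∉ G.candidates) :
    G.interactionProb p q r S = 0 := by
  have hnot : G.newVertex ∉ G.vertices := newVertex_notMem_of_subset (Finset.Subset.refl _)
  have h1 : G.candidates = G.triples ∪ G.pairs.image (insert G.newVertex) := by
    rw [candidates, Finset.range_add_one]
    exact Finset.powersetCard_succ_insert hnot 2
  rw [h1, Finset.mem_union, not_or] at hS
  by_cases hV : G.newVertex ∈ S
  · have h2 : S.erase G.newVertex ∉ G.pairs := fun h =>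
      hS.2 (Finset.mem_image.2 ⟨_, h, Finset.insert_erase hV⟩)
    have h3 : S.erase G.newVertex ∉ G.edges := fun h => h2 (mem_edges.1 h).1
    rw [interactionProb, if_pos hV, edgePrefProb, if_neg h3, pairUnifProb, if_neg h2]
    ring
  · have h3 : S ∉ G.triangles := fun h => hS.1 (Finset.mem_filter.1 h).1
    rw [interactionProb, if_neg hV, trianglePrefProb, if_neg h3, tripleUnifProb, if_neg hS.1]
    ring

/-- Undrawn pairs have weight 0, so one formula covers all pairs. -/
theorem Wellformed.edgePrefProb_eq (hG : G.Wellformed n) {e : Finset ℕ} (he : e ∈ G.pairs) :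
    G.edgePrefProb e = (G.weight e : ℝ) / (3 * ((n : ℝ) + 1)) := by
  have h1 : ∑ h ∈ G.edges, (G.weight h : ℝ) = 3 * ((n : ℝ) + 1) := by
    have h2 : ∑ h ∈ G.edges, G.weight h = ∑ h ∈ G.pairs, G.weight h :=
      Finset.sum_filter_of_ne fun x _ hx => Nat.pos_of_ne_zero hx
    rw [hG.sum_pairs] at h2
    exact_mod_cast h2
  rw [edgePrefProb, h1]
  split_ifs with h
  · rfl
  · have : G.weight e = 0 := by
      by_contra h0
      exact h (mem_edges.2 ⟨he, Nat.pos_of_ne_zero h0⟩)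
    simp [this]

theorem Wellformed.trianglePrefProb_eq (hG : G.Wellformed n) {t : Finset ℕ}
    (ht : t ∈ G.triples) : G.trianglePrefProb t = (G.weight t : ℝ) / ((n : ℝ) + 1) := by
  have h1 : ∑ h ∈ G.triangles, (G.weight h : ℝ) = (n : ℝ) + 1 := by
    have h2 : ∑ h ∈ G.triangles, G.weight h = ∑ h ∈ G.triples, G.weight h :=
      Finset.sum_filter_of_ne fun x _ hx => Nat.pos_of_ne_zero hx
    rw [hG.sum_triples] at h2
    exact_mod_cast h2
  rw [trianglePrefProb, h1]
  split_ifs with h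
  · rfl
  · have : G.weight t = 0 := by
      by_contra h0
      exact h (Finset.mem_filter.2 ⟨ht, Nat.pos_of_ne_zero h0⟩)
    simp [this]

theorem Wellformed.interactionProb_triple (hG : G.Wellformed n) {t : Finset ℕ}
    (ht : t ∈ G.triples) :
    G.interactionProb p q r t =
      (1 - p) * (q * ((G.weight t : ℝ) / ((n : ℝ) + 1)) + (1 - q) * (1 / (G.triples.card : ℝ))) := by
  rw [interactionProb, if_neg (newVertex_notMem_of_subset (mem_triples.1 ht).1),
    hG.trianglePrefProb_eq ht, tripleUnifProb, if_pos ht]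

theorem Wellformed.interactionProb_insert (hG : G.Wellformed n) {e : Finset ℕ}
    (he : e ∈ G.pairs) :
    G.interactionProb p q r (insert G.newVertex e) =
      p * (r * ((G.weight e : ℝ) / (3 * ((n : ℝ) + 1))) + (1 - r) * (1 / (G.pairs.card : ℝ))) := by
  rw [interactionProb, if_pos (Finset.mem_insert_self _ _),
    Finset.erase_insert (newVertex_notMem_of_subset (mem_pairs.1 he).1),
    hG.edgePrefProb_eq he, pairUnifProb, if_pos he]

theorem card_pairs (G : WeightedCliqueGraph) : G.pairs.card = G.numVertices.choose 2 := by
  rw [pairs, Finset.card_powersetCard, vertices, Finset.card_range]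

theorem card_triples (G : WeightedCliqueGraph) : G.triples.card = G.numVertices.choose 3 := by
  rw [triples, Finset.card_powersetCard, vertices, Finset.card_range]

theorem card_triples_superset {e : Finset ℕ} (he : e ∈ G.pairs) :
    (Finset.card {t ∈ G.triples | e ⊆ t}) = G.numVertices - 2 := by
  obtain ⟨he1, he2⟩ := mem_pairs.1 he
  have h1 : ({t ∈ G.triples | e ⊆ t} : Finset (Finset ℕ)) =
      (G.vertices \ e).image (fun x => insert x e) := by
    ext t
    rw [Finset.mem_filter, mem_triples, Finset.mem_image]
    constructor
    · rintro ⟨⟨h1, h2⟩, h3⟩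
      have h4 : (t \ e).card = 1 := by rw [Finset.card_sdiff_of_subset h3]; omega
      obtain ⟨x, hx⟩ := Finset.card_eq_one.1 h4
      have h5 : x ∈ t \ e := by rw [hx]; exact Finset.mem_singleton_self x
      rw [Finset.mem_sdiff] at h5
      refine ⟨x, Finset.mem_sdiff.2 ⟨h1 h5.1, h5.2⟩, ?_⟩
      rw [Finset.insert_eq, ← hx, Finset.sdiff_union_of_subset h3]
    · rintro ⟨x, hx, rfl⟩
      rw [Finset.mem_sdiff] at hx
      refine ⟨⟨Finset.insert_subset hx.1 he1, ?_⟩, Finset.subset_insert _ _⟩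
      rw [Finset.card_insert_of_notMem hx.2, he2]
  rw [h1, Finset.card_image_of_injOn, Finset.card_sdiff_of_subset he1, he2, vertices,
    Finset.card_range]
  intro x hx y hy hxy
  have hx' := (Finset.mem_sdiff.1 hx).2
  have h2 : x ∈ insert y e := by
    rw [← show insert x e = insert y e from hxy]
    exact Finset.mem_insert_self _ _
  exact (Finset.mem_insert.1 h2).resolve_right hx'

theorem Wellformed.card_triples_superset_div (hG : G.Wellformed n) {e : Finset ℕ}
    (he : e ∈ G.pairs) :
    ((Finset.card {t ∈ G.triples | e ⊆ t} : ℕ) : ℝ) * (1 / (G.triples.card : ℝ)) =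
      3 / (G.pairs.card : ℝ) := by
  have h3 := hG.three_le
  rw [card_triples_superset he, card_triples, card_pairs]
  have h1 := Nat.choose_succ_right_eq G.numVertices 2
  have h2 : (G.numVertices.choose 3 : ℝ) ≠ 0 := by
    exact_mod_cast (Nat.choose_pos h3).ne'
  have h4 : (G.numVertices.choose 2 : ℝ) ≠ 0 := by
    exact_mod_cast (Nat.choose_pos (by omega : 2 ≤ G.numVertices)).ne'
  have h5 : (G.numVertices.choose 3 : ℝ) * 3 =
      (G.numVertices.choose 2 : ℝ) * ((G.numVertices - 2 : ℕ) : ℝ) := by exact_mod_cast h1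
  rw [mul_one_div, div_eq_div_iff h2 h4]
  linarith

/-- The contribution of the uniform choices to the probability that a given edge takes part in an
interaction. -/
noncomputable def unifEdgeProb (p q r : ℝ) (G : WeightedCliqueGraph) : ℝ :=
  (p * (1 - r) + 3 * (1 - p) * (1 - q)) / (G.pairs.card : ℝ)

/-- The origin of `a`. Among old triples, the weights of those containing `e` add up to the weight
of `e`, giving `(1-p)q w/(n+1)`. With a new vertex, the other two vertices must be `e` itself,
giving `p r w/(3(n+1))`. -/
theorem Wellformed.sum_interactionProb_superset (hG : G.Wellformed n) {e : Finset ℕ}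
    (he : e ∈ G.pairs) :
    ∑ S ∈ G.candidates, (if e ⊆ S then G.interactionProb p q r S else 0) =
      (1 / 3 * p * r + (1 - p) * q) * (G.weight e : ℝ) / ((n : ℝ) + 1) +
        G.unifEdgeProb p q r := by
  obtain ⟨he1, he2⟩ := mem_pairs.1 he
  rw [sum_candidates]
  have h1 : ∑ t ∈ G.triples, (if e ⊆ t then G.interactionProb p q r t else 0) =
      (1 - p) * (q * ((G.weight e : ℝ) / ((n : ℝ) + 1)) + (1 - q) * (3 / (G.pairs.card : ℝ))) := by
    rw [← Finset.sum_filter, Finset.sum_congr rfl fun t ht =>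
      hG.interactionProb_triple (Finset.mem_filter.1 ht).1, ← Finset.mul_sum,
      Finset.sum_add_distrib, ← Finset.mul_sum, ← Finset.sum_div, Finset.sum_const, nsmul_eq_mul,
      mul_left_comm, hG.card_triples_superset_div he, hG.edge_weight e he2]
    push_cast
    rfl
  have h2 : ∑ e' ∈ G.pairs,
      (if e ⊆ insert G.newVertex e' then G.interactionProb p q r (insert G.newVertex e') else 0) =
      p * (r * ((G.weight e : ℝ) / (3 * ((n : ℝ) + 1))) + (1 - r) * (1 / (G.pairs.card : ℝ))) := by
    rw [← hG.interactionProb_insert (q := q) he, Finset.sum_eq_single_of_mem e he,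
      if_pos (Finset.subset_insert _ _)]
    intro e' he' hne
    rw [if_neg]
    intro hsub
    have h3 : e ⊆ e' := (Finset.subset_insert_iff_of_notMem
      (newVertex_notMem_of_subset he1)).1 hsub
    exact hne (Finset.eq_of_subset_of_card_le h3 (by rw [he2, (mem_pairs.1 he').2])).symm
  rw [h1, h2, unifEdgeProb]
  have : (n : ℝ) + 1 ≠ 0 := by positivity
  field_simp
  ring

theorem Wellformed.sum_interactionProb_newVertex (hG : G.Wellformed n) :
    ∑ S ∈ G.candidates, (if G.newVertex ∈ S then 1 else 0) * G.interactionProb p q r S = p := by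
  have h3 := hG.three_le
  have hn : (n : ℝ) + 1 ≠ 0 := by positivity
  have hc : (G.pairs.card : ℝ) ≠ 0 := by
    rw [card_pairs]
    exact_mod_cast (Nat.choose_pos (by omega : 2 ≤ G.numVertices)).ne'
  have hw : ∑ e ∈ G.pairs, (G.weight e : ℝ) = 3 * ((n : ℝ) + 1) := by exact_mod_cast hG.sum_pairs
  rw [sum_candidates, Finset.sum_eq_zero, zero_add]
  · simp_rw [if_pos (Finset.mem_insert_self _ _), one_mul]
    rw [Finset.sum_congr rfl fun e he => hG.interactionProb_insert he, ← Finset.mul_sum,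
      Finset.sum_add_distrib, ← Finset.mul_sum, ← Finset.sum_div, hw, Finset.sum_const,
      nsmul_eq_mul]
    field_simp
    ring
  · intro t ht
    rw [if_neg (newVertex_notMem_of_subset (mem_triples.1 ht).1), zero_mul]

theorem Wellformed.sum_card_filter_subset (hG : G.Wellformed n) {E : Finset (Finset ℕ)}
    (hE : E ⊆ G.pairs) :
    ∑ S ∈ G.candidates, ((Finset.card {e ∈ E | e ⊆ S} : ℕ) : ℝ) * G.interactionProb p q r S =
      ∑ e ∈ E, ((1 / 3 * p * r + (1 - p) * q) * (G.weight e : ℝ) / ((n : ℝ) + 1) +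
        G.unifEdgeProb p q r) := by
  rw [← Finset.sum_congr rfl fun e he => hG.sum_interactionProb_superset (hE he),
    Finset.sum_comm]
  refine Finset.sum_congr rfl fun S _ => ?_
  rw [← Finset.sum_filter, Finset.sum_const, nsmul_eq_mul]

theorem Wellformed.sum_card_hits (hG : G.Wellformed n) (v : ℕ) :
    ∑ S ∈ G.candidates, ((G.hits v S).card : ℝ) * G.interactionProb p q r S =
      (G.edgesOfWeight v).card *
        ((1 / 3 * p * r + (1 - p) * q) * v / ((n : ℝ) + 1) + G.unifEdgeProb p q r) := by
  have h := hG.sum_card_filter_subset (p := p) (q := q) (r := r) (E := G.edgesOfWeight v)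
    fun e he => (mem_edges.1 (mem_edgesOfWeight.1 he).1).1
  refine h.trans ?_
  rw [← nsmul_eq_mul, ← Finset.sum_const]
  refine Finset.sum_congr rfl fun e he => ?_
  rw [(mem_edgesOfWeight.1 he).2]

/-- The edge weights sum to `3(n+1)`, which cancels the denominator and leaves the constant `3a`. -/
theorem Wellformed.sum_card_allHits (hG : G.Wellformed n) :
    ∑ S ∈ G.candidates, ((G.allHits S).card : ℝ) * G.interactionProb p q r S =
      3 * (1 / 3 * p * r + (1 - p) * q) + G.edges.card * G.unifEdgeProb p q r := by
  have h := hG.sum_card_filter_subset (p := p) (q := q) (r := r) (E := G.edges)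
    fun e he => (mem_edges.1 he).1
  refine h.trans ?_
  have h2 : ∑ h ∈ G.edges, G.weight h = ∑ h ∈ G.pairs, G.weight h :=
    Finset.sum_filter_of_ne fun x _ hx => Nat.pos_of_ne_zero hx
  rw [hG.sum_pairs] at h2
  have h3 : ∑ h ∈ G.edges, (G.weight h : ℝ) = 3 * ((n : ℝ) + 1) := by exact_mod_cast h2
  rw [Finset.sum_add_distrib, Finset.sum_const, nsmul_eq_mul, ← Finset.sum_div, ← Finset.mul_sum,
    h3]
  have hn : (n : ℝ) + 1 ≠ 0 := by positivity
  field_simp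

end WeightedCliqueGraph

/-! ### From averaged increments to linear growth. -/

/-- A sequence with increments `x n`, where `x n` is on average close to
`c n - α * z n / (n + 1)`, grows linearly. -/
theorem tendsto_div_of_increments {z x c : ℕ → ℝ} {α β : ℝ} (hα : 0 ≤ α)
    (hc : Tendsto c atTop (𝓝 (β * (1 + α)))) (hz : ∀ n, z (n + 1) = z n + x n)
    (hx : Tendsto (fun n : ℕ =>
      (∑ k ∈ Finset.range n, (x k - (c k - α * z k / ((k : ℝ) + 1)))) / (n : ℝ)) atTop (𝓝 0)) :
    Tendsto (fun n : ℕ => z n / (n : ℝ)) atTop (𝓝 β) := by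
  set m : ℕ → ℝ := fun n => ∑ k ∈ Finset.range n, (x k - (c k - α * z k / ((k : ℝ) + 1))) with hm
  have hm1 : ∀ n, m (n + 1) = m n + (x n - (c n - α * z n / ((n : ℝ) + 1))) := fun n =>
    Finset.sum_range_succ _ n
  have hm0 : Tendsto (fun n : ℕ => m n / ((n : ℝ) + 1)) atTop (𝓝 0) := by
    refine squeeze_zero_norm' ?_ (tendsto_zero_iff_norm_tendsto_zero.1 hx)
    filter_upwards [eventually_gt_atTop 0] with n hn
    have hn0 : (0 : ℝ) < n := by exact_mod_cast hn
    rw [norm_div, norm_div, Real.norm_of_nonneg hn0.le,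
      Real.norm_of_nonneg (by positivity : (0 : ℝ) ≤ (n : ℝ) + 1)]
    gcongr
    linarith
  have h1 : Tendsto (fun n : ℕ => c n - α * (m n / ((n : ℝ) + 1))) atTop (𝓝 (β * (1 + α))) := by
    simpa using hc.sub (hm0.const_mul α)
  -- Subtracting the accumulated error `m` leaves an exact recurrence, with `c n` changed only by
  -- the null term `α m n/(n+1)`.
  have h2 := tendsto_div_of_recurrence (z := fun n => z n - m n) hα h1 fun n => by
    rw [hz, hm1]
    ring
  have h3 := h2.add hx
  rw [add_zero] at h3
  refine h3.congr fun n => ?_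
  rw [← add_div, sub_add_cancel]


open WeightedCliqueGraph

/-! ### The random graph process and its law of large numbers. -/

section

variable {Ω : Type*} {mΩ : MeasurableSpace Ω} {μ : Measure Ω} {p q r : ℝ}
  {ℱ : Filtration ℕ mΩ} {T : ℕ → Ω → Finset ℕ}

/-- The graph after `n` steps as a random variable. -/
def graphAt (T : ℕ → Ω → Finset ℕ) (n : ℕ) (ω : Ω) : WeightedCliqueGraph :=
  afterSteps (fun k => T k ω) n

theorem graphAt_succ (T : ℕ → Ω → Finset ℕ) (n : ℕ) (ω : Ω) :
    graphAt T (n + 1) ω = (graphAt T n ω).interact (T (n + 1) ω) := rfl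

theorem numVertices_graphAt_le (T : ℕ → Ω → Finset ℕ) (n : ℕ) (ω : Ω) :
    (graphAt T n ω).numVertices ≤ n + 3 := by
  induction n with
  | zero => exact le_rfl
  | succ n ih =>
    rw [graphAt_succ]
    have := (graphAt T n ω).numVertices_interact_le (T (n + 1) ω)
    omega

namespace IsThreeInteractionsModel

variable (hT : IsThreeInteractionsModel μ p q r ℱ T)
include hT

/-- No σ-algebra on graphs is needed: there are only countably many choices at each step, so every
set `A` is allowed. -/
theorem measurableSet_graphAt (n : ℕ) (A : Set WeightedCliqueGraph) :
    MeasurableSet[ℱ n] {ω | graphAt T n ω ∈ A} := by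
  induction n generalizing A with
  | zero => exact @MeasurableSet.const Ω (ℱ 0) (initial ∈ A)
  | succ n ih =>
    have h1 : {ω | graphAt T (n + 1) ω ∈ A} =
        ⋃ S : Finset ℕ, {ω | T (n + 1) ω = S} ∩ {ω | graphAt T n ω ∈ {g | g.interact S ∈ A}} := by
      ext ω
      simp [graphAt_succ]
    rw [h1]
    exact MeasurableSet.iUnion fun S => (hT.measurableSet_eq n S).inter
      (ℱ.mono n.le_succ _ (ih _))

theorem stronglyMeasurable_graphAt (n : ℕ) (f : WeightedCliqueGraph → ℝ) :
    StronglyMeasurable[ℱ n] fun ω => f (graphAt T n ω) :=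
  Measurable.stronglyMeasurable fun B _ => hT.measurableSet_graphAt n (f ⁻¹' B)

theorem stronglyMeasurable_step (n : ℕ) (d : WeightedCliqueGraph → Finset ℕ → ℝ) :
    StronglyMeasurable[ℱ (n + 1)] fun ω => d (graphAt T n ω) (T (n + 1) ω) := by
  refine Measurable.stronglyMeasurable fun B _ => ?_
  have h1 : (fun ω => d (graphAt T n ω) (T (n + 1) ω)) ⁻¹' B =
      ⋃ S : Finset ℕ, {ω | T (n + 1) ω = S} ∩ {ω | graphAt T n ω ∈ {g | d g S ∈ B}} := by
    ext ω
    simp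
  rw [h1]
  exact MeasurableSet.iUnion fun S => (hT.measurableSet_eq n S).inter
    (ℱ.mono n.le_succ _ (hT.measurableSet_graphAt n _))

theorem integrable_indicator [IsProbabilityMeasure μ] (n : ℕ) (S : Finset ℕ) :
    Integrable (Set.indicator {ω | T (n + 1) ω = S} (fun _ => (1 : ℝ))) μ :=
  (integrable_const 1).indicator (ℱ.le _ _ (hT.measurableSet_eq n S))

/-- The model prescribes only conditional probabilities. Integrating that of `S` over the past event
that `S` is not a candidate gives 0, and there are countably many `S`. -/
theorem ae_mem_candidates [IsProbabilityMeasure μ] :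
    ∀ᵐ ω ∂μ, ∀ n, T (n + 1) ω ∈ (graphAt T n ω).candidates := by
  rw [ae_all_iff]
  intro n
  have key : ∀ S : Finset ℕ, ∀ᵐ ω ∂μ, T (n + 1) ω = S → S ∈ (graphAt T n ω).candidates := by
    intro S
    set B : Set Ω := {ω | graphAt T n ω ∈ {g | S ∉ g.candidates}} with hB
    have hBm : MeasurableSet[ℱ n] B := hT.measurableSet_graphAt n _
    have hSm : MeasurableSet {ω | T (n + 1) ω = S} := ℱ.le _ _ (hT.measurableSet_eq n S)
    have h1 := setIntegral_condExp (ℱ.le n) (hT.integrable_indicator n S) hBm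
    have h2 : ∫ ω in B, (μ[Set.indicator {ω | T (n + 1) ω = S} (fun _ => (1 : ℝ)) | ℱ n]) ω ∂μ
        = 0 := by
      rw [setIntegral_congr_ae (g := fun _ => (0 : ℝ)) (ℱ.le n _ hBm)]
      · simp
      · filter_upwards [hT.condProb_eq n S] with ω hω hωB
        rw [hω]
        exact interactionProb_eq_zero hωB
    rw [h2, integral_indicator hSm, setIntegral_const, Measure.real,
      Measure.restrict_apply hSm, smul_eq_mul, mul_one] at h1
    have h3 : μ ({ω | T (n + 1) ω = S} ∩ B) = 0 :=
      ((ENNReal.toReal_eq_zero_iff _).1 h1.symm).resolve_right (measure_ne_top _ _)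
    rw [ae_iff]
    convert h3 using 2
    ext ω
    simp [hB]
  filter_upwards [ae_all_iff.2 key] with ω hω
  exact hω _ rfl

theorem ae_wellformed [IsProbabilityMeasure μ] :
    ∀ᵐ ω ∂μ, ∀ n, (graphAt T n ω).Wellformed n := by
  filter_upwards [hT.ae_mem_candidates] with ω hω n
  induction n with
  | zero => exact initial_wellformed
  | succ n ih => exact ih.interact (hω n)

theorem condExp_step [IsProbabilityMeasure μ] (n : ℕ) {d : WeightedCliqueGraph → Finset ℕ → ℝ}
    {C : ℝ} (hd : ∀ g S, S.card = 3 → |d g S| ≤ C) :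
    μ[fun ω => d (graphAt T n ω) (T (n + 1) ω) | ℱ n] =ᵐ[μ] fun ω =>
      ∑ S ∈ (graphAt T n ω).candidates,
        d (graphAt T n ω) S * (graphAt T n ω).interactionProb p q r S := by
  -- A deterministic finite set containing all candidates, since there are at most `n + 3` old
  -- vertices; it makes the conditional expectation a finite sum.
  set K : Finset (Finset ℕ) := (Finset.range (n + 4)).powersetCard 3 with hK
  have hsub : ∀ ω, (graphAt T n ω).candidates ⊆ K := fun ω =>
    Finset.powersetCard_mono (Finset.range_mono (by
      have := numVertices_graphAt_le T n ω
      omega))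
  set I : Finset ℕ → Ω → ℝ := fun S => Set.indicator {ω | T (n + 1) ω = S} (fun _ => (1 : ℝ))
  set F : Finset ℕ → Ω → ℝ := fun S ω => d (graphAt T n ω) S
  have hF : ∀ S, StronglyMeasurable[ℱ n] (F S) := fun S =>
    hT.stronglyMeasurable_graphAt n fun g => d g S
  have hb : ∀ S ∈ K, ∀ᵐ ω ∂μ, ‖F S ω‖ ≤ C := fun S hS =>
    ae_of_all _ fun ω => hd _ _ (Finset.mem_powersetCard.1 hS).2
  have h1 : (fun ω => d (graphAt T n ω) (T (n + 1) ω)) =ᵐ[μ] ∑ S ∈ K, F S * I S := by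
    filter_upwards [hT.ae_mem_candidates] with ω hω
    rw [Finset.sum_apply, Finset.sum_eq_single_of_mem _ (hsub ω (hω n))]
    · simp [F, I]
    · intro S _ hne
      have : I S ω = 0 := Set.indicator_of_notMem (fun h => hne h.symm) _
      simp [this]
  have hi : ∀ S ∈ K, Integrable (F S * I S) μ := fun S hS =>
    (hT.integrable_indicator n S).bdd_mul ((hF S).mono (ℱ.le n)).aestronglyMeasurable (hb S hS)
  refine (condExp_congr_ae h1).trans ((condExp_finsetSum hi _).trans ?_)
  have h2 : ∀ S ∈ K, ∀ᵐ ω ∂μ, (μ[F S * I S | ℱ n]) ω =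
      d (graphAt T n ω) S * (graphAt T n ω).interactionProb p q r S := by
    intro S hS
    filter_upwards [condExp_stronglyMeasurable_mul_of_bound (ℱ.le n) (hF S)
      (hT.integrable_indicator n S) C (hb S hS), hT.condProb_eq n S] with ω h3 h4
    rw [h3, Pi.mul_apply, h4]
    rfl
  filter_upwards [(ae_ball_iff K.countable_toSet).2 h2] with ω hω
  rw [Finset.sum_apply, Finset.sum_congr rfl hω]
  refine (Finset.sum_subset (hsub ω) fun S _ hS => ?_).symm
  rw [interactionProb_eq_zero hS, mul_zero]

theorem ae_tendsto_sum_step_div [IsProbabilityMeasure μ]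
    {d : WeightedCliqueGraph → Finset ℕ → ℝ} {C : ℝ} (hd : ∀ g S, S.card = 3 → |d g S| ≤ C) :
    ∀ᵐ ω ∂μ, Tendsto (fun n : ℕ => (∑ k ∈ Finset.range n, (d (graphAt T k ω) (T (k + 1) ω) -
      ∑ S ∈ (graphAt T k ω).candidates,
        d (graphAt T k ω) S * (graphAt T k ω).interactionProb p q r S)) / (n : ℝ))
      atTop (𝓝 0) := by
  have h1 := ae_tendsto_sum_sub_condExp_div (μ := μ) (ℱ := ℱ)
    (D := fun n ω => d (graphAt T n ω) (T (n + 1) ω)) (C := C)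
    (fun n => hT.stronglyMeasurable_step n d) fun n => by
      filter_upwards [hT.ae_mem_candidates] with ω hω
      exact hd _ _ (mem_candidates.1 (hω n)).2
  filter_upwards [h1, ae_all_iff.2 fun n => hT.condExp_step n hd] with ω h2 h3
  refine h2.congr fun n => ?_
  simp_rw [h3]

end IsThreeInteractionsModel

end

/-! ### Growth of the edge counts along a typical path. -/

theorem tendsto_add_div_of_tendsto_div {A B : ℕ → ℝ}
    (hA : Tendsto (fun n : ℕ => (∑ k ∈ Finset.range n, A k) / (n : ℝ)) atTop (𝓝 0))
    (hB : Tendsto (fun n : ℕ => (∑ k ∈ Finset.range n, B k) / (n : ℝ)) atTop (𝓝 0)) :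
    Tendsto (fun n : ℕ => (∑ k ∈ Finset.range n, (A k + B k)) / (n : ℝ)) atTop (𝓝 0) := by
  simpa [Finset.sum_add_distrib, add_div] using hA.add hB

theorem tendsto_neg_div_of_tendsto_div {A : ℕ → ℝ}
    (hA : Tendsto (fun n : ℕ => (∑ k ∈ Finset.range n, A k) / (n : ℝ)) atTop (𝓝 0)) :
    Tendsto (fun n : ℕ => (∑ k ∈ Finset.range n, -A k) / (n : ℝ)) atTop (𝓝 0) := by
  simpa [Finset.sum_neg_distrib, neg_div] using hA.neg

/-- A realization of the model along which all the laws of large numbers needed for the edge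
weights hold. -/
structure IsTypicalPath (p q r : ℝ) (G : ℕ → WeightedCliqueGraph) (S : ℕ → Finset ℕ) : Prop where
  succ : ∀ n, G (n + 1) = (G n).interact (S n)
  wellformed : ∀ n, (G n).Wellformed n
  mem_candidates : ∀ n, S n ∈ (G n).candidates
  newVertex : Tendsto (fun n : ℕ => (∑ k ∈ Finset.range n,
    ((if (G k).newVertex ∈ S k then 1 else 0) - p)) / (n : ℝ)) atTop (𝓝 0)
  allHits : Tendsto (fun n : ℕ => (∑ k ∈ Finset.range n, ((((G k).allHits (S k)).card : ℝ) -
    (3 * (1 / 3 * p * r + (1 - p) * q) + (G k).edges.card * (G k).unifEdgeProb p q r))) / (n : ℝ))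
    atTop (𝓝 0)
  hits : ∀ v, Tendsto (fun n : ℕ => (∑ k ∈ Finset.range n, ((((G k).hits v (S k)).card : ℝ) -
    ((G k).edgesOfWeight v).card *
      ((1 / 3 * p * r + (1 - p) * q) * v / ((k : ℝ) + 1) + (G k).unifEdgeProb p q r))) / (n : ℝ))
    atTop (𝓝 0)

theorem IsThreeInteractionsModel.ae_isTypicalPath {Ω : Type*} {mΩ : MeasurableSpace Ω}
    {μ : Measure Ω} [IsProbabilityMeasure μ] {p q r : ℝ} {ℱ : Filtration ℕ mΩ}
    {T : ℕ → Ω → Finset ℕ} (hT : IsThreeInteractionsModel μ p q r ℱ T) :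
    ∀ᵐ ω ∂μ, IsTypicalPath p q r (fun n => graphAt T n ω) (fun n => T (n + 1) ω) := by
  have h1 := hT.ae_tendsto_sum_step_div (C := 1)
    (d := fun g S => if g.newVertex ∈ S then 1 else 0) fun g S _ => by split_ifs <;> simp
  have h2 := hT.ae_tendsto_sum_step_div (C := 3) (d := fun g S => ((g.allHits S).card : ℝ))
    fun g S hS => by
      rw [Nat.abs_cast]
      exact_mod_cast g.card_allHits_le hS
  have h3 := fun v => hT.ae_tendsto_sum_step_div (C := 3)
    (d := fun g S => ((g.hits v S).card : ℝ)) fun g S hS => by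
      rw [Nat.abs_cast]
      exact_mod_cast g.card_hits_le v hS
  filter_upwards [hT.ae_mem_candidates, hT.ae_wellformed, h1, h2, ae_all_iff.2 h3] with
    ω hc hw h1 h2 h3
  refine ⟨fun n => rfl, hw, hc, ?_, ?_, fun v => ?_⟩
  · simpa only [(hw _).sum_interactionProb_newVertex] using h1
  · simpa only [(hw _).sum_card_allHits] using h2
  · simpa only [(hw _).sum_card_hits] using h3 v

namespace IsTypicalPath

variable {p q r : ℝ} {G : ℕ → WeightedCliqueGraph} {S : ℕ → Finset ℕ}

theorem tendsto_numVertices_div (h : IsTypicalPath p q r G S) :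
    Tendsto (fun n : ℕ => ((G n).numVertices : ℝ) / (n : ℝ)) atTop (𝓝 p) := by
  refine tendsto_div_of_increments (α := 0) (c := fun _ => p)
    (x := fun n => if (G n).newVertex ∈ S n then 1 else 0) le_rfl (by simp) (fun n => ?_) ?_
  · rw [h.succ, interact]
    split_ifs <;> simp
  · simpa using h.newVertex

/-- The number of pairs is `V(V-1)/2` with `V ~ p n` and `p > 0`, so the uniform contribution is of
order `n⁻²`. -/
theorem tendsto_mul_unifEdgeProb (h : IsTypicalPath p q r G S) (hp : 0 < p) :
    Tendsto (fun n : ℕ => (n : ℝ) * (G n).unifEdgeProb p q r) atTop (𝓝 0) := by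
  have h1 := h.tendsto_numVertices_div
  have h2 : Tendsto (fun n : ℕ => ((G n).numVertices : ℝ)) atTop atTop := by
    refine (h1.pos_mul_atTop hp tendsto_natCast_atTop_atTop).congr' ?_
    filter_upwards [eventually_gt_atTop 0] with n hn
    have : (n : ℝ) ≠ 0 := by positivity
    field_simp
  have h3 : Tendsto (fun n : ℕ => (((G n).numVertices : ℝ) - 1) / 2) atTop atTop :=
    (tendsto_atTop_add_const_right _ (-1) h2).atTop_div_const two_pos
  have h4 := (tendsto_const_nhds (x := p * (1 - r) + 3 * (1 - p) * (1 - q))).div_atTop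
    (h1.pos_mul_atTop hp h3)
  refine h4.congr' ?_
  filter_upwards [eventually_gt_atTop 0] with n hn
  have hn0 : (n : ℝ) ≠ 0 := by positivity
  have hV := (h.wellformed n).three_le
  have hV' : (3 : ℝ) ≤ (G n).numVertices := by exact_mod_cast hV
  rw [unifEdgeProb, card_pairs, Nat.cast_choose_two]
  have h5 : ((G n).numVertices : ℝ) ≠ 0 := by positivity
  have h6 : ((G n).numVertices : ℝ) - 1 ≠ 0 := by linarith
  field_simp

theorem tendsto_card_mul_unifEdgeProb (h : IsTypicalPath p q r G S) (hp : 0 < p)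
    {X : ℕ → ℕ} (hX : ∀ n, X n ≤ (G n).edges.card) :
    Tendsto (fun n : ℕ => (X n : ℝ) * (G n).unifEdgeProb p q r) atTop (𝓝 0) := by
  have h1 := ((h.tendsto_mul_unifEdgeProb hp).norm.const_mul 6)
  rw [norm_zero, mul_zero] at h1
  refine squeeze_zero_norm' ?_ h1
  filter_upwards [eventually_ge_atTop 1] with n hn
  have hle : X n ≤ 6 * n := by
    have := (hX n).trans (h.wellformed n).card_edges_le
    omega
  have hle' : (X n : ℝ) ≤ 6 * n := by exact_mod_cast hle
  rw [norm_mul, norm_mul, ← mul_assoc, Real.norm_natCast, Real.norm_natCast]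
  gcongr

theorem tendsto_card_edges_div (h : IsTypicalPath p q r G S) (hp : 0 < p) {a : ℝ}
    (ha : a = 1 / 3 * p * r + (1 - p) * q) :
    Tendsto (fun n : ℕ => ((G n).edges.card : ℝ) / (n : ℝ)) atTop (𝓝 (3 * (1 - a))) := by
  have hε := h.tendsto_card_mul_unifEdgeProb hp (X := fun n => (G n).edges.card) fun n => le_rfl
  refine tendsto_div_of_increments (α := 0)
    (c := fun n => 3 * (1 - a) - (G n).edges.card * (G n).unifEdgeProb p q r)
    (x := fun n => 3 - (((G n).allHits (S n)).card : ℝ)) le_rfl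
    (by simpa using hε.const_sub (3 * (1 - a))) (fun n => ?_) ?_
  · have h1 := (h.wellformed n).card_edges_interact (h.mem_candidates n)
    have h2 : ((((G n).interact (S n)).edges.card : ℕ) : ℝ) + ((G n).allHits (S n)).card =
      (G n).edges.card + 3 := by exact_mod_cast h1
    rw [h.succ]
    linarith
  · refine (tendsto_neg_div_of_tendsto_div h.allHits).congr fun n => ?_
    congr 1
    refine Finset.sum_congr rfl fun k _ => ?_
    rw [ha]
    ring

/-- Induction on `v` with loss rate `α = a v`. The gain is the number of new edges for `v = 1`;
afterwards it is the number of hits on the preceding weight, whose limiting mean comes from the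
induction hypothesis. -/
theorem tendsto_card_edgesOfWeight_div (h : IsTypicalPath p q r G S) (hp : 0 < p) {a : ℝ}
    (ha0 : 0 < a) (ha : a = 1 / 3 * p * r + (1 - p) * q) {v : ℕ} (hv : 1 ≤ v) :
    Tendsto (fun n : ℕ => (((G n).edgesOfWeight v).card : ℝ) / (n : ℝ)) atTop
      (𝓝 (3 * (1 - a) * limitWeight a v)) := by
  have hε := fun v => h.tendsto_card_mul_unifEdgeProb hp
    (X := fun n => ((G n).edgesOfWeight v).card) fun n => (G n).card_edgesOfWeight_le v
  induction v, hv using Nat.le_induction with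
  | base =>
    have hE := h.tendsto_card_mul_unifEdgeProb hp (X := fun n => (G n).edges.card)
      fun n => le_rfl
    refine tendsto_div_of_increments (α := a)
      (c := fun n => 3 * (1 - a) - (G n).edges.card * (G n).unifEdgeProb p q r -
        ((G n).edgesOfWeight 1).card * (G n).unifEdgeProb p q r)
      (x := fun n => 3 - (((G n).allHits (S n)).card : ℝ) - (((G n).hits 1 (S n)).card : ℝ))
      ha0.le ?_ (fun n => ?_) ?_
    · have h1 : 3 * (1 - a) * limitWeight a 1 * (1 + a) = 3 * (1 - a) - 0 - 0 := by
        simp only [limitWeight]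
        field_simp
        ring
      rw [h1]
      exact (hE.const_sub _).sub (hε 1)
    · have h1 := (h.wellformed n).card_edgesOfWeight_one_interact (h.mem_candidates n)
      have h2 : ((((G n).interact (S n)).edgesOfWeight 1).card : ℝ) + ((G n).hits 1 (S n)).card +
        ((G n).allHits (S n)).card = ((G n).edgesOfWeight 1).card + 3 := by exact_mod_cast h1
      rw [h.succ]
      linarith
    · refine (tendsto_neg_div_of_tendsto_div
        (tendsto_add_div_of_tendsto_div h.allHits (h.hits 1))).congr fun n => ?_
      congr 1
      refine Finset.sum_congr rfl fun k _ => ?_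
      rw [ha]
      push_cast
      ring
  | succ v hv ih =>
    refine tendsto_div_of_increments (α := a * ((v + 1 : ℕ) : ℝ))
      (c := fun n => ((G n).edgesOfWeight v).card * (a * v / ((n : ℝ) + 1) +
          (G n).unifEdgeProb p q r) -
        ((G n).edgesOfWeight (v + 1)).card * (G n).unifEdgeProb p q r)
      (x := fun n => (((G n).hits v (S n)).card : ℝ) - (((G n).hits (v + 1) (S n)).card : ℝ))
      (by positivity) ?_ (fun n => ?_) ?_
    · have h1 : 3 * (1 - a) * limitWeight a (v + 1) * (1 + a * ((v + 1 : ℕ) : ℝ)) =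
          a * v * (3 * (1 - a) * limitWeight a v * 1) + 0 - 0 := by
        rw [limitWeight_succ a (v := v + 1) (by omega), Nat.add_sub_cancel]
        have : ((v + 1 : ℕ) : ℝ) * a + 1 ≠ 0 := by positivity
        push_cast at this ⊢
        field_simp
        ring
      rw [h1]
      have h2 := ((ih.mul (tendsto_natCast_div_add_atTop (1 : ℝ))).const_mul (a * v)).add (hε v)
      refine (h2.sub (hε (v + 1))).congr' ?_
      filter_upwards [eventually_gt_atTop 0] with n hn
      have hn0 : (n : ℝ) ≠ 0 := by positivity
      have hn1 : (n : ℝ) + 1 ≠ 0 := by positivity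
      field_simp
    · have h1 := (h.wellformed n).card_edgesOfWeight_succ_interact (h.mem_candidates n) hv
      have h2 : ((((G n).interact (S n)).edgesOfWeight (v + 1)).card : ℝ) +
        ((G n).hits (v + 1) (S n)).card = ((G n).edgesOfWeight (v + 1)).card +
        ((G n).hits v (S n)).card := by exact_mod_cast h1
      rw [h.succ]
      linarith
    · refine (tendsto_add_div_of_tendsto_div (h.hits v)
        (tendsto_neg_div_of_tendsto_div (h.hits (v + 1)))).congr fun n => ?_
      congr 1
      refine Finset.sum_congr rfl fun k _ => ?_
      rw [ha]
      push_cast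
      ring

theorem tendsto_card_div_card (h : IsTypicalPath p q r G S) (hp : 0 < p) {a : ℝ}
    (ha0 : 0 < a) (ha1 : a < 1) (ha : a = 1 / 3 * p * r + (1 - p) * q) {v : ℕ} (hv : 1 ≤ v) :
    Tendsto (fun n : ℕ => (((G n).edgesOfWeight v).card : ℝ) / ((G n).edges.card : ℝ)) atTop
      (𝓝 (limitWeight a v)) := by
  have h0 : 3 * (1 - a) ≠ 0 := by
    have : 0 < 1 - a := by linarith
    positivity
  have h1 := (h.tendsto_card_edgesOfWeight_div hp ha0 ha hv).div
    (h.tendsto_card_edges_div hp ha) h0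
  rw [mul_div_cancel_left₀ _ h0] at h1
  refine h1.congr' ?_
  filter_upwards [eventually_gt_atTop 0] with n hn
  have hn0 : (n : ℝ) ≠ 0 := by positivity
  exact div_div_div_cancel_right₀ hn0 _ _

end IsTypicalPath

theorem mainTheorem1 {Ω : Type*} {mΩ : MeasurableSpace Ω} (μ : Measure Ω) [IsProbabilityMeasure μ]
    (p q r : ℝ) (hp0 : 0 < p) (hp1 : p ≤ 1) (hq0 : 0 ≤ q) (hq1 : q ≤ 1) (hr0 : 0 ≤ r) (hr1 : r ≤ 1)
    (hrq : 0 < r ∨ 0 < (1 - p) * q)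
    (ℱ : Filtration ℕ mΩ) (T : ℕ → Ω → Finset ℕ) (hT : IsThreeInteractionsModel μ p q r ℱ T)
    (a : ℝ) (ha : a = 1 / 3 * p * r + (1 - p) * q) :
    ∃ u : ℕ → ℝ,
      (∀ v : ℕ, 1 ≤ v → 0 < u v) ∧
      (∀ v : ℕ, 1 ≤ v → ∀ᵐ ω ∂μ,
        Tendsto (fun n : ℕ => (numEdgesOfWeight T n v ω : ℝ) / (numEdges T n ω : ℝ))
          atTop (𝓝 (u v))) ∧
      u 1 = 1 / (a + 1) ∧
      (∀ v : ℕ, 1 < v → u v = ((v : ℝ) - 1) * a / ((v : ℝ) * a + 1) * u (v - 1)) ∧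
      HasSum (fun k : ℕ => u (k + 1)) 1 ∧
      Tendsto (fun v : ℕ =>
          u v / (Real.Gamma (1 + 1 / a) / a * (v : ℝ) ^ (-(1 + 1 / a))))
        atTop (𝓝 1) := by
  have hpq : 0 ≤ (1 - p) * q := mul_nonneg (by linarith) hq0
  have ha0 : 0 < a := by
    have hpr : 0 ≤ 1 / 3 * p * r := by positivity
    rcases hrq with h | h
    · have : 0 < 1 / 3 * p * r := by positivity
      linarith
    · linarith
  -- In fact `a ≤ p/3 + (1 - p) = 1 - 2p/3`. This makes the growth rate `3(1-a)` of `E_n` nonzero,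
  -- as the division requires.
  have ha1 : a < 1 := by
    have h1 : p * r ≤ p := mul_le_of_le_one_right hp0.le hr1
    have h2 : (1 - p) * q ≤ 1 - p := mul_le_of_le_one_right (by linarith) hq1
    linarith
  refine ⟨limitWeight a, fun v hv => limitWeight_pos ha0 hv, fun v hv => ?_, rfl,
    fun v hv => limitWeight_succ a hv, hasSum_limitWeight ha0, tendsto_limitWeight_div ha0⟩
  filter_upwards [hT.ae_isTypicalPath] with ω hω
  exact hω.tendsto_card_div_card hp0 ha0 ha1 ha hv
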